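/- Let $S$ be an oriented interval $I$ or an oriented circle $S^1$. A \emph{legally directed diagram} on $S$ is a finite graph attached to $S$ whose internal edges are arrows, whose external vertices (finitely many, taken in their order along $S$) are each the end of exactly one arrow, and whose internal vertices are trivalent, cyclically oriented, with exactly one ingoing and two outgoing arrows; loops and multiple edges are allowed, and every internal component is attached to $S$. Diagrams are taken up to isomorphism. Let $\overrightarrow{\mathcal A}(S)$ be the complex vector space they span, modulo the directed relations: - AS: reversing the cyclic orientation at one internal vertex changes the sign; - IHX: $I=H-X$ for every arrow joining two different internal vertices (each of $I,H,X$ with its legal directing); - STU: for two neighbouring external vertices, (legs parallel) $-$ (legs crossed) $=$ (the two legs joined at a new internal vertex, which is connected to $S$ by a new arrow), where the directing of the new arrow is the one that makes the new vertex legal; if both legs point towards $S$ there is no such directing and the right-hand side is $0$. The degree of a diagram is the number of its arrows minus the number of its internal vertices. A diagram is \emph{primitive} if it is nonempty and connected after $S$ is removed. A \emph{directed $\theta$} is a diagram consisting of a single arrow with both ends on $S$. For $m\ge 1$, the two \emph{directed $m$-wheels} consist of an oriented cycle of $m$ arrows (directed counterclockwise or clockwise), drawn in the plane, and one further arrow from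 each of its $m$ vertices to $S$, these legs being placed on $S$ in the order of the vertices around the cycle. Then: 1. For every $m\ge1$, both directed $m$-wheels are primitive diagrams of degree $m$, and their classes in $\overrightarrow{\mathcal A}(I)$ are nonzero. 2. Wheels and possibly $\theta$ are the only nonzero primitives in $\overrightarrow{\mathcal A}(I)$: every primitive diagram is a directed $\theta$, or its degree $m$ is at least $1$ and its class in $\overrightarrow{\mathcal A}(I)$ is a scalar multiple of the class of each of the two directed $m$-wheels. 3. In contrast, the classes of all directed wheels in $\overrightarrow{\mathcal A}(S^1)$ are zero, and so is the class of every primitive diagram that is not a directed $\theta$. -/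

import Mathlib

/-- The Wilson line on which diagrams are based: an oriented interval or an oriented circle. -/
inductive Skeleton
  | interval
  | circle

/-- The two ends of an arrow (a directed internal edge). -/
inductive ArrowEnd
  | tail
  | head

open Classical in
/-- A legally directed trivalent diagram on a Wilson line, with finite set `V` of internal vertices
and finite set `E` of internal edges, each edge being an arrow.

* Every internal vertex `v` has exactly three legs: one ingoing arrow `inn v` and two outgoing
  arrows `out v 0`, `out v 1`.  Its cyclic orientation is `(inn v, out v 0, out v 1)`.
* `base` lists the external vertices (those on the Wilson line) in the order in which they are
  met along the line; such a vertex is the end `k` of the arrow `e` for an entry `(e, k)`.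
  So `(e, head)` is a leg pointing towards the line, `(e, tail)` a leg pointing away from it.
  For the circle, the list is read cyclically (see `LegalDiagram.Iso`).
* Every arrow has exactly one head and exactly one tail, each at a vertex.

Loops and multiple edges are allowed.  By `LegalDiagram.exists_reachable_base`, the graph formed by
such a diagram together with its Wilson line is automatically connected. -/
structure LegalDiagram (V E : Type) [Fintype V] [Fintype E] where
  inn : V → E
  out : V → Fin 2 → E
  base : List (E × ArrowEnd)
  head_once : ∀ e : E,
    (Finset.univ.filter fun v : V => inn v = e).card + base.countP (fun p => p = (e, ArrowEnd.head)) = 1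
  tail_once : ∀ e : E,
    (Finset.univ.filter fun p : V × Fin 2 => out p.1 p.2 = e).card
      + base.countP (fun p => p = (e, ArrowEnd.tail)) = 1

namespace LegalDiagram

variable {V E : Type} [Fintype V] [Fintype E]

/-- The arrow `e` is one of the legs of the internal vertex `v`. -/
def Incident (D : LegalDiagram V E) (v : V) (e : E) : Prop :=
  D.inn v = e ∨ ∃ i, D.out v i = e

/-- Two arrows are joined when they meet at an internal vertex. -/
def edgeGraph (D : LegalDiagram V E) : SimpleGraph E :=
  SimpleGraph.fromRel fun e f => ∃ v, D.Incident v e ∧ D.Incident v f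

/-- A diagram is primitive if it is connected (in particular nonempty) once the Wilson line is
removed.  As every internal vertex has legs and every external vertex is then the end of exactly
one arrow, this says that any two arrows are linked through internal vertices. -/
def IsPrimitive (D : LegalDiagram V E) : Prop := D.edgeGraph.Connected

/-- The degree: every arrow counts `+1`, every internal vertex counts `-1`. -/
def degree (_D : LegalDiagram V E) : ℤ := (Fintype.card E : ℤ) - Fintype.card V

/-- Two lists of external vertices describe the same Wilson line. -/
def SameLine {α : Type} : Skeleton → List α → List α → Prop
  | .interval, l, l' => l = l'
  | .circle, l, l' => l.IsRotated l'

/-- Isomorphism of diagrams on a given Wilson line: it preserves the arrows, the cyclic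
orientations of the internal vertices, and the order along the (oriented) line. -/
def Iso (sk : Skeleton) {V E V' E' : Type} [Fintype V] [Fintype E] [Fintype V'] [Fintype E']
    (D : LegalDiagram V E) (D' : LegalDiagram V' E') : Prop :=
  ∃ (φ : V ≃ V') (ψ : E ≃ E'),
    (∀ v, D'.inn (φ v) = ψ (D.inn v)) ∧
    (∀ v i, D'.out (φ v) i = ψ (D.out v i)) ∧
    SameLine sk (D.base.map fun p => (ψ p.1, p.2)) D'.base

theorem incident_reachable (D : LegalDiagram V E) {v : V} {e f : E}
    (he : D.Incident v e) (hf : D.Incident v f) : D.edgeGraph.Reachable e f := by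
  by_cases h : e = f
  · subst h; exact SimpleGraph.Reachable.refl _
  · refine SimpleGraph.Adj.reachable ?_
    rw [edgeGraph, SimpleGraph.fromRel_adj]
    exact ⟨h, Or.inl ⟨v, he, hf⟩⟩

open Classical in
/-- Every arrow of a legally directed diagram is connected to the Wilson line. -/
theorem exists_reachable_base (D : LegalDiagram V E) (e : E) :
    ∃ f k, (f, k) ∈ D.base ∧ D.edgeGraph.Reachable e f := by
  by_contra hcon
  have hb : ∀ f k, D.edgeGraph.Reachable e f → D.base.countP (fun p => p = (f, k)) = 0 := by
    intro f k hf
    refine List.countP_eq_zero.mpr fun p hp h => hcon ⟨f, k, ?_, hf⟩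
    rw [← of_decide_eq_true h]
    exact hp
  set C : Finset E := Finset.univ.filter fun f => D.edgeGraph.Reachable e f with hC
  set A : Finset V := Finset.univ.filter fun v => D.inn v ∈ C with hA
  set B : Finset (V × Fin 2) := Finset.univ.filter fun p => D.out p.1 p.2 ∈ C with hB
  have h1 : A.card = C.card := by
    rw [Finset.card_eq_sum_card_fiberwise (f := D.inn) (t := C) (by intro v hv; simpa [hA] using hv),
      Finset.card_eq_sum_ones]
    refine Finset.sum_congr rfl fun f hf => ?_
    have h := D.head_once f
    rw [hb f _ (by simpa [hC] using hf), add_zero] at h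
    rw [← h, hA, Finset.filter_filter]
    congr 1
    ext v
    simp only [Finset.mem_filter, Finset.mem_univ, true_and]
    exact ⟨fun h => h.2, fun h => ⟨h ▸ hf, h⟩⟩
  have h2 : B.card = C.card := by
    rw [Finset.card_eq_sum_card_fiberwise (f := fun p : V × Fin 2 => D.out p.1 p.2) (t := C)
      (by intro v hv; simpa [hB] using hv), Finset.card_eq_sum_ones]
    refine Finset.sum_congr rfl fun f hf => ?_
    have h := D.tail_once f
    rw [hb f _ (by simpa [hC] using hf), add_zero] at h
    rw [← h, hB, Finset.filter_filter]
    congr 1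
    ext v
    simp only [Finset.mem_filter, Finset.mem_univ, true_and]
    exact ⟨fun h => h.2, fun h => ⟨h ▸ hf, h⟩⟩
  have h3 : B = A ×ˢ (Finset.univ : Finset (Fin 2)) := by
    ext ⟨v, i⟩
    simp only [hA, hB, hC, Finset.mem_filter, Finset.mem_univ, true_and, Finset.mem_product,
      and_true]
    have h := D.incident_reachable (v := v) (Or.inl rfl) (Or.inr ⟨i, rfl⟩)
    exact ⟨fun h' => h'.trans h.symm, fun h' => h'.trans h⟩
  have h4 : B.card = A.card * 2 := by rw [h3, Finset.card_product]; simp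
  have h5 : 0 < C.card := Finset.card_pos.mpr ⟨e, by simp [hC]⟩
  omega

end LegalDiagram

/-- A legally directed diagram with arbitrary finite sets of internal vertices and of arrows. -/
structure AnyDiagram : Type 1 where
  V : Type
  E : Type
  [fintypeV : Fintype V]
  [fintypeE : Fintype E]
  diagram : LegalDiagram V E

attribute [instance] AnyDiagram.fintypeV AnyDiagram.fintypeE

namespace LegalDiagram

/-- A diagram as a generator of the free complex vector space on all diagrams. -/
noncomputable def gen {V E : Type} [Fintype V] [Fintype E] (D : LegalDiagram V E) :
    AnyDiagram →₀ ℂ :=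
  Finsupp.single ⟨V, E, D⟩ 1

/-- `S` and `T` differ only by the exchange of two neighbouring external vertices: along the line,
`S` reads `l, p, q, r` and `T` reads `l, q, p, r`. -/
def IsSwap {V E : Type} [Fintype V] [Fintype E] (S T : LegalDiagram V E)
    (l : List (E × ArrowEnd)) (p q : E × ArrowEnd) (r : List (E × ArrowEnd)) : Prop :=
  T.inn = S.inn ∧ T.out = S.out ∧ S.base = l ++ p :: q :: r ∧ T.base = l ++ q :: p :: r

/-- `U` has one internal vertex `none` and one arrow `none` more than `S`.  It agrees with `S`,
except that the two neighbouring external vertices of `S` between `l` and `r` are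
replaced by a single one, which is the end `k` of the new arrow. -/
def IsMerge {V E : Type} [Fintype V] [Fintype E] (S : LegalDiagram V E)
    (U : LegalDiagram (Option V) (Option E))
    (l : List (E × ArrowEnd)) (k : ArrowEnd) (r : List (E × ArrowEnd)) : Prop :=
  (∀ v, U.inn (some v) = some (S.inn v)) ∧
  (∀ v i, U.out (some v) i = some (S.out v i)) ∧
  U.base = l.map (fun p => (some p.1, p.2)) ++ (none, k) :: r.map (fun p => (some p.1, p.2))

/-- The relations between legally directed diagrams on the Wilson line `sk`.

In the directed STU relations `S - T = U`, the neighbouring legs of `S` belong to the arrows `e` and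
`f`, from left to right, and `U` is drawn as the letter Y standing on the line, with `e` at the
upper left, `f` at the upper right, the new arrow at the bottom, and the counterclockwise cyclic
orientation `(e, new, f)`. -/
inductive IsRelator (sk : Skeleton) : (AnyDiagram →₀ ℂ) → Prop
  /-- Isomorphic diagrams are identified. -/
  | iso {V E V' E' : Type} [Fintype V] [Fintype E] [Fintype V'] [Fintype E']
      (D : LegalDiagram V E) (D' : LegalDiagram V' E') (h : Iso sk D D') :
      IsRelator sk (D.gen - D'.gen)
  /-- Directed AS: reversing the cyclic orientation of one internal vertex changes the sign. -/
  | antisymm {V E : Type} [Fintype V] [Fintype E] (D D' : LegalDiagram V E) (v : V)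
      (hinn : D'.inn = D.inn) (hbase : D'.base = D.base)
      (hv : D'.out v = ![D.out v 1, D.out v 0])
      (hout : ∀ u, u ≠ v → D'.out u = D.out u) :
      IsRelator sk (D.gen + D'.gen)
  /-- Directed IHX, `I = H - X`, at an arrow `c` from the internal vertex `v` to the internal
  vertex `w ≠ v`.  One outer leg goes in (the arrow `inn v`) and three go out (`x`, `y`, `z`). -/
  | ihx {V E : Type} [Fintype V] [Fintype E] (I H X : LegalDiagram V E) (v w : V) (c x y z : E)
      (hvw : v ≠ w)
      (hHi : H.inn = I.inn) (hXi : X.inn = I.inn)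
      (hHb : H.base = I.base) (hXb : X.base = I.base)
      (hHo : ∀ u, u ≠ v → u ≠ w → H.out u = I.out u)
      (hXo : ∀ u, u ≠ v → u ≠ w → X.out u = I.out u)
      (hc : I.inn w = c)
      (hIv : I.out v = ![x, c]) (hIw : I.out w = ![y, z])
      (hHv : H.out v = ![c, z]) (hHw : H.out w = ![x, y])
      (hXv : X.out v = ![c, y]) (hXw : X.out w = ![x, z]) :
      IsRelator sk (I.gen - (H.gen - X.gen))
  /-- Directed STU, both legs pointing up (away from the line). -/
  | stu_up_up {V E : Type} [Fintype V] [Fintype E] (S T : LegalDiagram V E)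
      (U : LegalDiagram (Option V) (Option E)) (l r : List (E × ArrowEnd)) (e f : E)
      (hT : IsSwap S T l (e, .tail) (f, .tail) r) (hU : IsMerge S U l .tail r)
      (hinn : U.inn none = none) (hout : U.out none = ![some f, some e]) :
      IsRelator sk (S.gen - T.gen - U.gen)
  /-- Directed STU, left leg pointing up and right leg pointing down. -/
  | stu_up_down {V E : Type} [Fintype V] [Fintype E] (S T : LegalDiagram V E)
      (U : LegalDiagram (Option V) (Option E)) (l r : List (E × ArrowEnd)) (e f : E)
      (hT : IsSwap S T l (e, .tail) (f, .head) r) (hU : IsMerge S U l .head r)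
      (hinn : U.inn none = some f) (hout : U.out none = ![some e, none]) :
      IsRelator sk (S.gen - T.gen - U.gen)
  /-- Directed STU, left leg pointing down and right leg pointing up. -/
  | stu_down_up {V E : Type} [Fintype V] [Fintype E] (S T : LegalDiagram V E)
      (U : LegalDiagram (Option V) (Option E)) (l r : List (E × ArrowEnd)) (e f : E)
      (hT : IsSwap S T l (e, .head) (f, .tail) r) (hU : IsMerge S U l .head r)
      (hinn : U.inn none = some e) (hout : U.out none = ![none, some f]) :
      IsRelator sk (S.gen - T.gen - U.gen)
  /-- Directed STU, both legs pointing down (towards the line): there is no legal `U`. -/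
  | stu_down_down {V E : Type} [Fintype V] [Fintype E] (S T : LegalDiagram V E)
      (l r : List (E × ArrowEnd)) (e f : E)
      (hT : IsSwap S T l (e, .head) (f, .head) r) :
      IsRelator sk (S.gen - T.gen)

end LegalDiagram

/-- The space of legally directed diagrams on the Wilson line `sk`, modulo the directed STU, IHX
and AS relations. -/
abbrev DirectedSpace (sk : Skeleton) : Type 1 :=
  (AnyDiagram →₀ ℂ) ⧸ Submodule.span ℂ {x | LegalDiagram.IsRelator sk x}

namespace LegalDiagram

/-- The class of a diagram in the space of legally directed diagrams on `sk`. -/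
noncomputable def cls (sk : Skeleton) {V E : Type} [Fintype V] [Fintype E]
    (D : LegalDiagram V E) : DirectedSpace sk :=
  Submodule.Quotient.mk D.gen

/-- The directed `θ`: a single arrow with both ends on the line; `true` means that the tail comes
first along the line, `false` that the head comes first. -/
def theta (b : Bool) : LegalDiagram Empty Unit where
  inn := Empty.elim
  out := fun v => v.elim
  base := if b then [((), .tail), ((), .head)] else [((), .head), ((), .tail)]
  head_once := by cases b <;> simp
  tail_once := by cases b <;> simp

/-- The diagram is a directed `θ`. -/
def IsTheta (sk : Skeleton) {V E : Type} [Fintype V] [Fintype E] (D : LegalDiagram V E) : Prop :=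
  ∃ b, Iso sk D (theta b)

/-- The two directed wheels with `m ≥ 1` legs.  The wheel is drawn in the plane above the line, so
that its rim vertices `0, 1, …, m - 1`, in counterclockwise order, have legs ending on the line
from left to right.  `Sum.inl i` is the rim arrow pointing into the rim vertex `i`, and `Sum.inr i`
is the leg from the rim vertex `i` to the line.  The rim is directed counterclockwise for
`ccw = true` and clockwise for `ccw = false`; the internal vertices are oriented
counterclockwise. -/
def wheel (m : ℕ) [NeZero m] (ccw : Bool) : LegalDiagram (Fin m) (Fin m ⊕ Fin m) where
  inn := fun i => .inl i
  out := fun i => if ccw then ![.inr i, .inl (i + 1)] else ![.inl (i - 1), .inr i]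
  base := (List.finRange m).map fun i => (.inr i, .head)
  head_once := by
    rintro (j | j)
    · simp [List.countP_map, List.countP_eq_zero, Finset.filter_eq']
    · have h := List.count_eq_one_of_mem (List.nodup_finRange m) (List.mem_finRange j)
      rw [List.count_eq_countP] at h
      simp only [List.countP_map, reduceCtorEq, Finset.filter_false, Finset.card_empty, zero_add]
      rw [← h]
      congr 1
      ext i
      simp [beq_eq_decide]
  tail_once := by
    intro e
    rw [List.countP_eq_zero.mpr (by simp), add_zero, Finset.card_eq_one]
    rcases e with j | j <;> cases ccw
    · refine ⟨(j + 1, 0), ?_⟩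
      ext ⟨v, i⟩
      fin_cases i <;> simp [sub_eq_iff_eq_add]
    · refine ⟨(j - 1, 1), ?_⟩
      ext ⟨v, i⟩
      fin_cases i <;> simp [eq_sub_iff_add_eq]
    · refine ⟨(j, 1), ?_⟩
      ext ⟨v, i⟩
      fin_cases i <;> simp
    · refine ⟨(j, 0), ?_⟩
      ext ⟨v, i⟩
      fin_cases i <;> simp

end LegalDiagram

/-!
The line carries two kinds of legs: heads (pointing towards it) and tails (pointing away from it).
By the directed STU relations two heads commute, and a head passes a tail at the cost of a diagram
in which the two are merged, which has one external vertex less.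

*Classification.* Take a primitive diagram with an internal vertex, on either kind of line. Suppose
first that some vertex is a fork, that is, both its outgoing arrows end on the line. Moving these
two heads next to each other costs merged diagrams, which are again primitive of the same degree and
are dealt with by induction on the number of external vertices. Once the two heads are neighbours,
the diagram vanishes: they commute, and exchanging them reverses the orientation of the vertex
(`cls_eq_zero_of_neighbours`, `cls_mem_of_fork`). If no vertex is a fork, each vertex has an outgoing
arrow that enters another vertex. By counting, this defines a permutation of the vertices; by
connectedness the permutation is transitive and no other arrows exist, except one leg at each vertex.
Such a diagram is a wheel up to orientations of the vertices and the order of the heads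
(`cls_mem_span_wheel_of_no_fork`). A primitive diagram without internal vertices is a single arrow.

*The circle.* Cutting a wheel open at a vertex writes it, by STU, as the difference of two diagrams
with exactly one tail on the line, which differ by moving this tail past a head. On the circle the
tail can be brought to the first place by rotation, after which the heads commute, so the two
diagrams agree (`cls_circle_eq_of_swap`, `cls_circle_wheel_ccw`).

*The interval.* The wheels are detected by a weight system. For a Lie algebra with a representation
of its semidirect product with its dual, sum over all labellings of the arrows by a basis: internal
vertices contribute structure constants, tails on the line act by basis elements, and heads by dual
basis elements, which commute with each other as the directed STU relations demand. For the Lie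
algebra with `[x, y] = y`, only one labelling of a wheel contributes, with `y` on the rim and `x` on
the legs. In the representation by differential operators on `ℂ[X]` used here the dual element `x*`
acts as `1`, so that wheels have the value `±1` (`weightMap_relator`, `weight_wheel`).
-/

namespace LegalDiagram

/-! ### Legality in terms of injectivity and membership -/

section Legality

variable {V E : Type} [Fintype V] [Fintype E]

theorem countP_eq_count {α : Type*} [BEq α] [LawfulBEq α] (l : List α) (a : α)
    [DecidablePred fun p => p = a] : l.countP (fun p => p = a) = l.count a := by
  rw [List.count_eq_countP]
  congr 1
  ext i
  rw [Bool.eq_iff_iff]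
  simp

theorem countP_eq_ite_of_nodup {α : Type*} {l : List α} (hl : l.Nodup) (a : α)
    [DecidablePred fun p => p = a] [Decidable (a ∈ l)] :
    l.countP (fun p => p = a) = if a ∈ l then 1 else 0 := by
  classical
  rw [countP_eq_count]
  split_ifs with ha
  · exact List.count_eq_one_of_mem hl ha
  · exact List.count_eq_zero_of_not_mem ha

theorem inn_injective (D : LegalDiagram V E) : Function.Injective D.inn := by
  classical
  intro v w h
  have h1 := D.head_once (D.inn w)
  have h2 : (Finset.univ.filter fun u : V => D.inn u = D.inn w).card ≤ 1 := by
    convert Nat.le.intro h1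
  exact Finset.card_le_one.mp h2 v (by simp [h]) w (by simp)

theorem out_injective (D : LegalDiagram V E) {v w : V} {i j : Fin 2} (h : D.out v i = D.out w j) :
    v = w ∧ i = j := by
  classical
  have h1 := D.tail_once (D.out w j)
  have h2 : (Finset.univ.filter fun p : V × Fin 2 => D.out p.1 p.2 = D.out w j).card ≤ 1 := by
    convert Nat.le.intro h1
  simpa using Finset.card_le_one.mp h2 (v, i) (by simp [h]) (w, j) (by simp)

theorem head_mem_base (D : LegalDiagram V E) (e : E) :
    (e, ArrowEnd.head) ∈ D.base ↔ ∀ v, D.inn v ≠ e := by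
  classical
  have h1 := D.head_once e
  constructor
  · intro he v hv
    have h2 : 0 < D.base.countP (fun p => p = (e, ArrowEnd.head)) :=
      List.countP_pos_iff.mpr ⟨_, he, by simp⟩
    have h3 : 0 < (Finset.univ.filter fun v : V => D.inn v = e).card :=
      Finset.card_pos.mpr ⟨v, by simp [hv]⟩
    have h4 : D.base.countP (fun p => p = (e, ArrowEnd.head)) +
      (Finset.univ.filter fun v : V => D.inn v = e).card = 1 := by
      rw [add_comm]; convert h1
    omega
  · intro h
    rw [Finset.filter_eq_empty_iff.mpr (by simpa using h), Finset.card_empty, zero_add] at h1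
    obtain ⟨p, hp, hpe⟩ := List.countP_pos_iff.mp (h1 ▸ Nat.one_pos)
    rw [← of_decide_eq_true hpe]
    exact hp

theorem tail_mem_base (D : LegalDiagram V E) (e : E) :
    (e, ArrowEnd.tail) ∈ D.base ↔ ∀ v i, D.out v i ≠ e := by
  classical
  have h1 := D.tail_once e
  constructor
  · intro he v i hv
    have h2 : 0 < D.base.countP (fun p => p = (e, ArrowEnd.tail)) :=
      List.countP_pos_iff.mpr ⟨_, he, by simp⟩
    have h3 : 0 < (Finset.univ.filter fun p : V × Fin 2 => D.out p.1 p.2 = e).card :=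
      Finset.card_pos.mpr ⟨(v, i), by simp [hv]⟩
    have h4 : D.base.countP (fun p => p = (e, ArrowEnd.tail)) +
      (Finset.univ.filter fun p : V × Fin 2 => D.out p.1 p.2 = e).card = 1 := by
      rw [add_comm]; convert h1
    omega
  · intro h
    rw [Finset.filter_eq_empty_iff.mpr (by simpa using h), Finset.card_empty, zero_add] at h1
    obtain ⟨p, hp, hpe⟩ := List.countP_pos_iff.mp (h1 ▸ Nat.one_pos)
    rw [← of_decide_eq_true hpe]
    exact hp

theorem nodup_base (D : LegalDiagram V E) : D.base.Nodup := by
  classical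
  rw [List.nodup_iff_count_le_one]
  intro a
  rw [← countP_eq_count]
  rcases a with ⟨e, _ | _⟩
  · have := D.tail_once e
    refine (?_ : _ ≤ _ + _).trans_eq this
    convert Nat.le_add_left _ _
  · have := D.head_once e
    refine (?_ : _ ≤ _ + _).trans_eq this
    convert Nat.le_add_left _ _

/-- A legal diagram from its incidence data, the counting conditions being replaced by: no two
internal vertices share an end of an arrow, no end is repeated on the line, and an end lies on the
line exactly if it lies at no internal vertex. -/
def ofInjective (inn : V → E) (out : V → Fin 2 → E) (base : List (E × ArrowEnd))
    (hinn : Function.Injective inn) (hout : ∀ v w i j, out v i = out w j → v = w ∧ i = j)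
    (hbase : base.Nodup) (hhead : ∀ e, (e, ArrowEnd.head) ∈ base ↔ ∀ v, inn v ≠ e)
    (htail : ∀ e, (e, ArrowEnd.tail) ∈ base ↔ ∀ v i, out v i ≠ e) : LegalDiagram V E where
  inn := inn
  out := out
  base := base
  head_once e := by
    classical
    rw [countP_eq_ite_of_nodup hbase]
    by_cases h : ∃ v, inn v = e
    · obtain ⟨v, hv⟩ := h
      rw [if_neg (fun hm => (hhead e).mp hm v hv), add_zero, Finset.card_eq_one]
      exact ⟨v, by ext w; simpa [← hv] using hinn.eq_iff⟩
    · push Not at h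
      rw [if_pos ((hhead e).mpr h), Finset.filter_eq_empty_iff.mpr (by simpa using h),
        Finset.card_empty]
  tail_once e := by
    classical
    rw [countP_eq_ite_of_nodup hbase]
    by_cases h : ∃ v i, out v i = e
    · obtain ⟨v, i, hv⟩ := h
      rw [if_neg (fun hm => (htail e).mp hm v i hv), add_zero, Finset.card_eq_one]
      refine ⟨(v, i), ?_⟩
      ext ⟨w, j⟩
      simp only [Finset.mem_filter, Finset.mem_univ, true_and, Finset.mem_singleton, Prod.mk.injEq]
      exact ⟨fun hw => hout _ _ _ _ (hw.trans hv.symm), by rintro ⟨rfl, rfl⟩; exact hv⟩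
    · push Not at h
      rw [if_pos ((htail e).mpr h), Finset.filter_eq_empty_iff.mpr (by simpa using h),
        Finset.card_empty]

theorem ext_data {D D' : LegalDiagram V E} (hinn : D.inn = D'.inn) (hout : D.out = D'.out)
    (hbase : D.base = D'.base) : D = D' := by
  cases D; cases D'; simp_all

theorem isPrimitive_congr {D D' : LegalDiagram V E} (hinn : D'.inn = D.inn) (hout : D'.out = D.out)
    (h : D.IsPrimitive) : D'.IsPrimitive := by
  have : D'.edgeGraph = D.edgeGraph := by
    simp only [edgeGraph, Incident, hinn, hout]
  rwa [IsPrimitive, this]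

/-- The two outgoing ends at each vertex carry different arrows, so there are at least twice as many
arrows as internal vertices. -/
theorem card_le_degree (D : LegalDiagram V E) : (Fintype.card V : ℤ) ≤ D.degree := by
  have h := Fintype.card_le_of_injective (fun p : V × Fin 2 => D.out p.1 p.2)
    (fun p q h => Prod.ext_iff.mpr (D.out_injective h))
  rw [Fintype.card_prod, Fintype.card_fin] at h
  unfold degree
  omega

theorem exists_degree_eq_succ [Nonempty V] (D : LegalDiagram V E) :
    ∃ k : ℕ, D.degree = (k + 1 : ℕ) := by
  have h := D.card_le_degree
  have hV : 0 < Fintype.card V := Fintype.card_pos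
  exact ⟨(D.degree - 1).toNat, by omega⟩

/-! ### Operations on diagrams -/

/-- The same diagram with its external vertices rearranged along the line. -/
def withBase (D : LegalDiagram V E) (b : List (E × ArrowEnd)) (h : D.base.Perm b) :
    LegalDiagram V E :=
  ofInjective D.inn D.out b D.inn_injective (fun _ _ _ _ => D.out_injective)
    (h.nodup_iff.mp D.nodup_base) (fun e => h.mem_iff.symm.trans (D.head_mem_base e))
    (fun e => h.mem_iff.symm.trans (D.tail_mem_base e))

open Classical in
/-- The diagram with the cyclic orientation of the internal vertex `v` reversed. -/
noncomputable def flipAt (D : LegalDiagram V E) (v : V) : LegalDiagram V E :=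
  ofInjective D.inn (fun u => if u = v then ![D.out u 1, D.out u 0] else D.out u) D.base
    D.inn_injective
    (by
      intro u w i j h
      split_ifs at h <;> fin_cases i <;> fin_cases j <;>
        · have h' := D.out_injective (by simpa using h)
          simp_all)
    D.nodup_base D.head_mem_base
    (by
      intro e
      rw [D.tail_mem_base]
      refine forall_congr' fun u => ?_
      split_ifs
      · simp [Fin.forall_fin_two, and_comm]
      · rfl)

/-- Renaming of the internal vertices and of the arrows. -/
def relabel {V' E' : Type} [Fintype V'] [Fintype E'] (D : LegalDiagram V E) (φ : V ≃ V')
    (ψ : E ≃ E') : LegalDiagram V' E' :=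
  ofInjective (fun v => ψ (D.inn (φ.symm v))) (fun v i => ψ (D.out (φ.symm v) i))
    (D.base.map fun p => (ψ p.1, p.2))
    (ψ.injective.comp (D.inn_injective.comp φ.symm.injective))
    (fun v w i j h => by simpa using D.out_injective (ψ.injective h))
    (D.nodup_base.map fun p q h => by simpa [Prod.ext_iff] using h)
    (fun e => by
      obtain ⟨e, rfl⟩ := ψ.surjective e
      rw [φ.symm.forall_congr_left]
      simpa using D.head_mem_base e)
    (fun e => by
      obtain ⟨e, rfl⟩ := ψ.surjective e
      rw [φ.symm.forall_congr_left]
      simpa using D.tail_mem_base e)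

theorem SameLine.refl {α : Type} (sk : Skeleton) (l : List α) : SameLine sk l l := by
  cases sk
  · rfl
  · exact List.IsRotated.refl l

theorem iso_relabel {V' E' : Type} [Fintype V'] [Fintype E'] (sk : Skeleton) (D : LegalDiagram V E)
    (φ : V ≃ V') (ψ : E ≃ E') : Iso sk D (D.relabel φ ψ) :=
  ⟨φ, ψ, fun v => by simp [relabel, ofInjective], fun v i => by simp [relabel, ofInjective],
    SameLine.refl _ _⟩

/-- The diagram obtained by joining two neighbouring legs, a left one `e` pointing towards the line
and a right one `f` pointing away from it, at a new internal vertex; this is the right-hand side of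
the relation `stu_down_up`. -/
def merge (D : LegalDiagram V E) (l r : List (E × ArrowEnd)) (e f : E)
    (h : D.base = l ++ (e, .head) :: (f, .tail) :: r) : LegalDiagram (Option V) (Option E) :=
  have hnd : (l ++ (e, ArrowEnd.head) :: (f, ArrowEnd.tail) :: r).Nodup := h ▸ D.nodup_base
  have he : ∀ v, D.inn v ≠ e := (D.head_mem_base e).mp (by simp [h])
  have hf : ∀ v i, D.out v i ≠ f := (D.tail_mem_base f).mp (by simp [h])
  ofInjective (fun o => o.elim (some e) fun v => some (D.inn v))
    (fun o => o.elim ![none, some f] fun v i => some (D.out v i))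
    (l.map (fun p => (some p.1, p.2)) ++ (none, .head) :: r.map (fun p => (some p.1, p.2)))
    (by
      rintro (_ | v) (_ | w) hvw
      · rfl
      · exact absurd (Option.some_injective _ hvw).symm (he w)
      · exact absurd (Option.some_injective _ hvw) (he v)
      · exact congrArg _ (D.inn_injective (Option.some_injective _ hvw)))
    (by
      rintro (_ | v) (_ | w) i j hvw
      · fin_cases i <;> fin_cases j <;> simp_all
      · fin_cases i
        · simp at hvw
        · exact absurd (by simpa using hvw.symm) (hf w j)
      · fin_cases j
        · simp at hvw
        · exact absurd (by simpa using hvw) (hf v i)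
      · simpa using D.out_injective (Option.some_injective _ hvw))
    (by
      have hinj : Function.Injective fun p : E × ArrowEnd => (some p.1, p.2) :=
        fun p q hpq => by simpa [Prod.ext_iff] using hpq
      have h1 : (l ++ r).Nodup :=
        hnd.sublist (List.Sublist.append (List.Sublist.refl l)
          ((List.sublist_cons_self _ _).trans (List.sublist_cons_self _ _)))
      have h2 := h1.map hinj
      rw [List.map_append] at h2
      rw [List.nodup_middle, List.nodup_cons]
      exact ⟨by simp, h2⟩)
    (by
      rintro (_ | a)
      · simp [Option.forall]
      · have h1 := D.head_mem_base a
        rw [h] at h1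
        rw [List.nodup_middle] at hnd
        have h2 := (List.nodup_cons.mp hnd).1
        simp only [List.mem_append, List.mem_cons, Prod.mk.injEq, reduceCtorEq, and_false, and_true,
          false_or] at h1 h2
        simp only [List.mem_append, List.mem_cons, List.mem_map, Prod.mk.injEq, Option.some.injEq,
          Option.forall, Option.elim, reduceCtorEq, false_and, false_or, Prod.exists, ne_eq]
        simp only [↓existsAndEq, and_true]
        grind)
    (by
      rintro (_ | a)
      · simp only [List.mem_append, List.mem_cons, List.mem_map, Prod.mk.injEq, reduceCtorEq,
          false_and, and_false, exists_false, or_self, false_iff, not_forall]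
        exact ⟨none, 0, by simp⟩
      · have h1 := D.tail_mem_base a
        rw [h] at h1
        rw [← List.singleton_append, ← List.append_assoc, List.nodup_middle] at hnd
        have h2 := (List.nodup_cons.mp hnd).1
        simp only [List.mem_append, List.mem_cons, Prod.mk.injEq, reduceCtorEq, and_false, and_true,
          false_or, or_false, List.not_mem_nil] at h1 h2
        simp only [List.mem_append, List.mem_cons, List.mem_map, Prod.mk.injEq, Option.some.injEq,
          Option.forall, Option.elim, reduceCtorEq, false_and, false_or, Prod.exists, ne_eq,
          Fin.forall_fin_two]
        simp only [↓existsAndEq, and_true]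
        simp only [Fin.forall_fin_two, ne_eq] at h1
        simp
        grind)

theorem degree_merge (D : LegalDiagram V E) (l r : List (E × ArrowEnd)) (e f : E)
    (h : D.base = l ++ (e, .head) :: (f, .tail) :: r) :
    (D.merge l r e f h).degree = D.degree := by
  simp [degree]

theorem length_base_merge (D : LegalDiagram V E) (l r : List (E × ArrowEnd)) (e f : E)
    (h : D.base = l ++ (e, .head) :: (f, .tail) :: r) :
    (D.merge l r e f h).base.length < D.base.length := by
  simp [h, merge, ofInjective]

theorem isPrimitive_merge (D : LegalDiagram V E) (l r : List (E × ArrowEnd)) (e f : E)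
    (h : D.base = l ++ (e, .head) :: (f, .tail) :: r) (hD : D.IsPrimitive) :
    (D.merge l r e f h).IsPrimitive := by
  set U := D.merge l r e f h with hU
  have hinc : ∀ v a, D.Incident v a → U.Incident (some v) (some a) := by
    rintro v a (rfl | ⟨i, rfl⟩)
    · exact Or.inl rfl
    · exact Or.inr ⟨i, rfl⟩
  have hsome : ∀ a b, U.edgeGraph.Reachable (some a) (some b) := by
    intro a b
    refine (hD.preconnected a b).map ⟨some, ?_⟩
    intro a b hab
    rw [edgeGraph, SimpleGraph.fromRel_adj] at hab ⊢
    obtain ⟨hne, hab⟩ := hab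
    refine ⟨fun h => hne (Option.some_injective _ h), hab.imp ?_ ?_⟩ <;>
    · rintro ⟨v, h1, h2⟩
      exact ⟨some v, hinc _ _ h1, hinc _ _ h2⟩
  have hnone : U.edgeGraph.Reachable none (some e) :=
    U.incident_reachable (v := none) (Or.inr ⟨0, rfl⟩) (Or.inl rfl)
  have key : ∀ a, U.edgeGraph.Reachable a (some e) := by
    rintro (_ | a)
    · exact hnone
    · exact hsome a e
  exact ⟨fun a b => (key a).trans (key b).symm⟩

/-! ### Consequences of the relations -/

theorem cls_eq_of_iso {V' E' : Type} [Fintype V'] [Fintype E'] {sk : Skeleton}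
    {D : LegalDiagram V E} {D' : LegalDiagram V' E'} (h : Iso sk D D') : D.cls sk = D'.cls sk :=
  (Submodule.Quotient.eq _).mpr (Submodule.subset_span (IsRelator.iso D D' h))

theorem cls_flipAt (sk : Skeleton) (D : LegalDiagram V E) (v : V) :
    (D.flipAt v).cls sk = -D.cls sk := by
  have h : IsRelator sk (D.gen + (D.flipAt v).gen) :=
    IsRelator.antisymm D _ v rfl rfl (by simp [flipAt, ofInjective])
      (fun u hu => by simp [flipAt, ofInjective, hu])
  rw [eq_neg_iff_add_eq_zero, add_comm]
  exact (Submodule.Quotient.mk_eq_zero _).mpr (Submodule.subset_span h)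

theorem cls_eq_of_swap_heads (sk : Skeleton) {S T : LegalDiagram V E} {l r : List (E × ArrowEnd)}
    {e f : E} (h : IsSwap S T l (e, .head) (f, .head) r) : S.cls sk = T.cls sk :=
  (Submodule.Quotient.eq _).mpr (Submodule.subset_span (IsRelator.stu_down_down S T l r e f h))

theorem cls_sub_eq_merge (sk : Skeleton) {S T : LegalDiagram V E} {l r : List (E × ArrowEnd)}
    {e f : E} (h : IsSwap S T l (e, .head) (f, .tail) r) :
    S.cls sk - T.cls sk = (S.merge l r e f h.2.2.1).cls sk := by
  rw [← sub_eq_zero]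
  exact (Submodule.Quotient.mk_eq_zero _).mpr (Submodule.subset_span
    (IsRelator.stu_down_up S T _ l r e f h ⟨fun _ => rfl, fun _ _ => rfl, rfl⟩ rfl rfl))

/-- Consecutive legs pointing towards the line may be permuted freely. -/
theorem cls_eq_of_perm_heads (sk : Skeleton) {A A' : List (E × ArrowEnd)} (hA : A.Perm A') :
    ∀ {D D' : LegalDiagram V E} (l r : List (E × ArrowEnd)), (∀ p ∈ A, p.2 = ArrowEnd.head) →
      D'.inn = D.inn → D'.out = D.out → D.base = l ++ A ++ r → D'.base = l ++ A' ++ r →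
      D.cls sk = D'.cls sk := by
  induction hA with
  | nil =>
    intro D D' l r _ hi ho hb hb'
    rw [ext_data hi.symm ho.symm (hb.trans hb'.symm)]
  | cons x _ ih =>
    intro D D' l r hh hi ho hb hb'
    exact ih (l ++ [x]) r (fun p hp => hh p (List.mem_cons_of_mem _ hp)) hi ho
      (by simpa using hb) (by simpa using hb')
  | swap x y A =>
    intro D D' l r hh hi ho hb hb'
    obtain ⟨x, kx⟩ := x
    obtain ⟨y, ky⟩ := y
    obtain rfl : kx = _ := hh (x, kx) (by simp)
    obtain rfl : ky = _ := hh (y, ky) (by simp)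
    exact cls_eq_of_swap_heads sk (l := l) (r := A ++ r) ⟨hi, ho, by simpa using hb,
      by simpa using hb'⟩
  | @trans A B C hAB hBC ih ih' =>
    intro D D' l r hh hi ho hb hb'
    have hp : D.base.Perm (l ++ B ++ r) := by
      rw [hb]
      exact (hAB.append_left l).append_right r
    refine (ih (D := D) (D' := D.withBase _ hp) l r hh rfl rfl hb rfl).trans
      (ih' l r (fun p hp => hh p (hAB.mem_iff.mpr hp)) hi ho rfl hb')

end Legality

section Reduction

variable {V E : Type} [Fintype V] [Fintype E]

/-! ### Diagrams with a fork of two legs -/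

/-- A leg pointing towards the line may be moved to the right across the legs in `A`, at the cost of
diagrams with fewer external vertices: legs pointing towards the line are crossed freely, and
crossing one that points away from the line produces a merged diagram. -/
theorem cls_mem_of_move_head (sk : Skeleton) (W : Submodule ℂ (DirectedSpace sk)) {e : E}
    {r : List (E × ArrowEnd)} (A : List (E × ArrowEnd)) :
    ∀ (l : List (E × ArrowEnd)) {D D' : LegalDiagram V E}, D.IsPrimitive →
      (∀ U : LegalDiagram (Option V) (Option E), U.IsPrimitive → U.degree = D.degree →
        U.base.length < D.base.length → U.cls sk ∈ W) →
      D'.inn = D.inn → D'.out = D.out → D.base = l ++ (e, .head) :: (A ++ r) →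
      D'.base = l ++ A ++ (e, .head) :: r → D'.cls sk ∈ W → D.cls sk ∈ W := by
  induction A with
  | nil =>
    intro l D D' _ _ hi ho hb hb' h
    rwa [ext_data hi.symm ho.symm (by rw [hb, hb']; simp)]
  | cons x A ih =>
    intro l D D' hD hU hi ho hb hb' h
    have hp : D.base.Perm (l ++ x :: (e, .head) :: (A ++ r)) := by
      rw [hb]
      exact (List.Perm.swap _ _ _).append_left l
    set T := D.withBase _ hp with hT
    have hswap : IsSwap D T l (e, .head) x (A ++ r) := ⟨rfl, rfl, by simpa using hb, rfl⟩
    have hTW : T.cls sk ∈ W := by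
      refine ih (l ++ [x]) (D := T) (D' := D') (isPrimitive_congr rfl rfl hD) ?_ hi ho ?_ ?_ h
      · intro U h1 h2 h3
        exact hU U h1 h2 (h3.trans_eq hp.length_eq.symm)
      · simp [hT, withBase, ofInjective]
      · simpa using hb'
    obtain ⟨f, _ | _⟩ := x
    · have hsub := cls_sub_eq_merge sk hswap
      rw [sub_eq_iff_eq_add] at hsub
      rw [hsub]
      exact W.add_mem (hU _ (isPrimitive_merge _ _ _ _ _ _ hD) (degree_merge _ _ _ _ _ _)
        (length_base_merge _ _ _ _ _ _)) hTW
    · rwa [cls_eq_of_swap_heads sk hswap]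

/-- If both outgoing arrows of a vertex end at neighbouring places of the line, the diagram
vanishes: exchanging these two ends does not change its class, and amounts to reversing the
orientation of the vertex. -/
theorem cls_eq_zero_of_neighbours (sk : Skeleton) (D : LegalDiagram V E) (v : V) {a b : E}
    {l r : List (E × ArrowEnd)} (hb : D.base = l ++ (a, .head) :: (b, .head) :: r)
    (hab : D.out v = ![a, b] ∨ D.out v = ![b, a]) : D.cls sk = 0 := by
  classical
  have ha_inn := (D.head_mem_base a).mp (by simp [hb])
  have hb_inn := (D.head_mem_base b).mp (by simp [hb])
  have hp : D.base.Perm (l ++ (b, .head) :: (a, .head) :: r) := by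
    rw [hb]
    exact (List.Perm.swap _ _ _).append_left l
  have h1 : D.cls sk = (D.withBase _ hp).cls sk :=
    cls_eq_of_swap_heads sk ⟨rfl, rfl, hb, rfl⟩
  have hout : ∀ u i, u ≠ v → D.out u i ≠ a ∧ D.out u i ≠ b := by
    intro u i hu
    constructor <;> rintro rfl <;> rcases hab with h | h
    · exact hu (D.out_injective (v := u) (i := i) (w := v) (j := 0) (by simp [h])).1
    · exact hu (D.out_injective (v := u) (i := i) (w := v) (j := 1) (by simp [h])).1
    · exact hu (D.out_injective (v := u) (i := i) (w := v) (j := 1) (by simp [h])).1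
    · exact hu (D.out_injective (v := u) (i := i) (w := v) (j := 0) (by simp [h])).1
  have htail : (a, ArrowEnd.tail) ∉ D.base ∧ (b, ArrowEnd.tail) ∉ D.base := by
    rw [D.tail_mem_base, D.tail_mem_base]
    push Not
    rcases hab with h | h
    · exact ⟨⟨v, 0, by simp [h]⟩, v, 1, by simp [h]⟩
    · exact ⟨⟨v, 1, by simp [h]⟩, v, 0, by simp [h]⟩
  have hfix : ∀ p ∈ l ++ r, (Equiv.swap a b p.1, p.2) = p := by
    have hnd := D.nodup_base
    rw [hb] at hnd htail
    rintro ⟨e, k⟩ hp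
    have hea : e ≠ a := by
      rintro rfl
      cases k
      · exact htail.1 (by simp at hp ⊢; tauto)
      · rw [List.nodup_middle] at hnd
        exact (List.nodup_cons.mp hnd).1 (by simp at hp ⊢; tauto)
    have heb : e ≠ b := by
      rintro rfl
      cases k
      · exact htail.2 (by simp at hp ⊢; tauto)
      · rw [← List.singleton_append, ← List.append_assoc, List.nodup_middle] at hnd
        exact (List.nodup_cons.mp hnd).1 (by simp at hp ⊢; tauto)
    simp [Equiv.swap_apply_of_ne_of_ne hea heb]
  have hmap : ∀ s : List (E × ArrowEnd), (∀ p ∈ s, p ∈ l ++ r) →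
      s.map (fun p => (Equiv.swap a b p.1, p.2)) = s := by
    intro s hs
    conv_rhs => rw [← List.map_id s]
    exact List.map_congr_left fun p hp => hfix p (hs p hp)
  have h2 : Iso sk (D.withBase _ hp) (D.flipAt v) := by
    refine ⟨Equiv.refl V, Equiv.swap a b, fun u => ?_, fun u i => ?_, ?_⟩
    · simp [withBase, flipAt, ofInjective,
        Equiv.swap_apply_of_ne_of_ne (ha_inn u) (hb_inn u)]
    · by_cases hu : u = v
      · subst hu
        rcases hab with h | h <;> fin_cases i <;> simp [withBase, flipAt, ofInjective, h]
      · simp [withBase, flipAt, ofInjective, hu,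
          Equiv.swap_apply_of_ne_of_ne (hout u i hu).1 (hout u i hu).2]
    · have : (D.withBase _ hp).base.map (fun p => (Equiv.swap a b p.1, p.2)) =
          (D.flipAt v).base := by
        simp [withBase, flipAt, ofInjective, hb, hmap l (by simp +contextual),
          hmap r (by simp +contextual)]
      rw [this]
      exact SameLine.refl _ _
  rw [cls_eq_of_iso h2, cls_flipAt] at h1
  have h3 : (2 : ℂ) • D.cls sk = 0 := by
    rw [two_smul]
    nth_rewrite 1 [h1]
    exact neg_add_cancel _
  exact (smul_eq_zero.mp h3).resolve_left two_ne_zero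

/-- A diagram in which both outgoing arrows of some vertex end on the line is a combination of
primitive diagrams with fewer external vertices. -/
theorem cls_mem_of_fork (sk : Skeleton) (W : Submodule ℂ (DirectedSpace sk))
    (D : LegalDiagram V E) (hD : D.IsPrimitive)
    (hU : ∀ U : LegalDiagram (Option V) (Option E), U.IsPrimitive → U.degree = D.degree →
        U.base.length < D.base.length → U.cls sk ∈ W)
    (v : V) (hv : ∀ i w, D.inn w ≠ D.out v i) : D.cls sk ∈ W := by
  have key : ∀ (a b : E) (l A r : List (E × ArrowEnd)),
      D.out v = ![a, b] ∨ D.out v = ![b, a] →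
      D.base = l ++ (a, .head) :: (A ++ (b, .head) :: r) → D.cls sk ∈ W := by
    intro a b l A r hab hb
    have hp : D.base.Perm (l ++ A ++ (a, .head) :: (b, .head) :: r) := by
      rw [hb, List.append_assoc]
      exact (List.perm_middle.symm).append_left l
    refine cls_mem_of_move_head sk W A l (D' := D.withBase _ hp) hD hU rfl rfl hb rfl ?_
    rw [cls_eq_zero_of_neighbours sk (D.withBase _ hp) v (l := l ++ A) (r := r) rfl hab]
    exact W.zero_mem
  have h0 := (D.head_mem_base (D.out v 0)).mpr (hv 0)
  have h1 := (D.head_mem_base (D.out v 1)).mpr (hv 1)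
  obtain ⟨l, r, hlr⟩ := List.append_of_mem h0
  rw [hlr, List.mem_append, List.mem_cons] at h1
  have hvec : D.out v = ![D.out v 0, D.out v 1] := by
    ext i
    fin_cases i <;> rfl
  rcases h1 with h1 | h1 | h1
  · obtain ⟨l', A, rfl⟩ := List.append_of_mem h1
    exact key (D.out v 1) (D.out v 0) l' A r (Or.inr hvec) (by simpa using hlr)
  · have := D.out_injective (Prod.ext_iff.mp h1).1
    simp at this
  · obtain ⟨A, r', rfl⟩ := List.append_of_mem h1
    exact key (D.out v 0) (D.out v 1) l A r' (Or.inl hvec) hlr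

/-! ### Diagrams without forks are wheels -/

/-- Diagrams that differ only by the cyclic orientations of internal vertices have proportional
classes. -/
theorem cls_mem_span_of_flips (sk : Skeleton) (s : Finset V) :
    ∀ {D D' : LegalDiagram V E}, D'.inn = D.inn → D'.base = D.base →
      (∀ v ∉ s, D'.out v = D.out v) → (∀ v ∈ s, D'.out v = ![D.out v 1, D.out v 0]) →
      D.cls sk ∈ Submodule.span ℂ {D'.cls sk} := by
  classical
  induction s using Finset.induction with
  | empty =>
    intro D D' hi hb h _
    rw [ext_data hi (funext fun v => h v (by simp)) hb]
    exact Submodule.mem_span_singleton_self _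
  | insert v s hvs ih =>
    intro D D' hi hb h h'
    rw [← neg_neg (D.cls sk), ← cls_flipAt sk D v]
    refine Submodule.neg_mem _ (ih hi hb (fun u hu => ?_) fun u hu => ?_)
    · by_cases huv : u = v
      · subst huv
        simpa [flipAt, ofInjective] using h' u (by simp)
      · simpa [flipAt, ofInjective, huv] using h u (by simp [huv, hu])
    · have huv : u ≠ v := by rintro rfl; exact hvs hu
      simpa [flipAt, ofInjective, huv] using h' u (by simp [hu])

/-- A transitive permutation of a finite set is a cyclic shift. -/
theorem exists_equiv_fin_of_transitive [Nonempty V] (c : Equiv.Perm V)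
    (hc : ∀ O : Set V, O.Nonempty → (∀ v, v ∈ O ↔ c v ∈ O) → O = Set.univ) :
    ∃ (m : ℕ) (_ : NeZero m) (φ : Fin m ≃ V), ∀ i, c (φ i) = φ (i + 1) := by
  obtain ⟨v₀⟩ := ‹Nonempty V›
  have hpos : 0 < Function.minimalPeriod c v₀ :=
    Function.minimalPeriod_pos_of_mem_periodicPts
      ((Function.Injective.mem_periodicPts c.injective) v₀)
  set m := Function.minimalPeriod c v₀ with hm
  have hmod : ∀ n, c^[n % m] v₀ = c^[n] v₀ := fun n => Function.iterate_mod_minimalPeriod_eq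
  have : NeZero m := ⟨hpos.ne'⟩
  have hO : Set.range (fun n : ℕ => c^[n] v₀) = Set.univ := by
    refine hc _ ⟨v₀, 0, rfl⟩ fun v => ⟨?_, ?_⟩
    · rintro ⟨n, rfl⟩
      exact ⟨n + 1, Function.iterate_succ_apply' c n v₀⟩
    · rintro ⟨n, hn⟩
      refine ⟨n + (m - 1), c.injective ?_⟩
      simp only
      rw [← Function.iterate_succ_apply' c, ← hn, ← hmod,
        show (n + (m - 1)).succ = n + m by omega, Nat.add_mod_right, hmod]
  refine ⟨m, this, Equiv.ofBijective (fun i : Fin m => c^[(i : ℕ)] v₀) ⟨?_, ?_⟩, fun i => ?_⟩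
  · intro i j hij
    exact Fin.ext (Function.iterate_injOn_Iio_minimalPeriod i.2 j.2 hij)
  · intro v
    obtain ⟨n, rfl⟩ : v ∈ Set.range (fun n : ℕ => c^[n] v₀) := hO ▸ Set.mem_univ v
    exact ⟨⟨n % m, Nat.mod_lt _ hpos⟩, hmod n⟩
  · change c (c^[(i : ℕ)] v₀) = c^[((i + 1 : Fin m) : ℕ)] v₀
    rw [← Function.iterate_succ_apply' c, Fin.val_add, Fin.val_one', Nat.add_mod_mod,
      hmod]

/-- If at every vertex some outgoing arrow is the ingoing arrow of a vertex, then in a primitive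
diagram these arrows form a single oriented cycle through all vertices: each vertex has one such
arrow by counting, and the vertices of one cycle together with their legs form a component. The
other outgoing arrows then end on the line, where they may be permuted. -/
theorem cls_mem_span_wheel_of_no_fork (sk : Skeleton) (D : LegalDiagram V E) (hD : D.IsPrimitive)
    [Nonempty V] (hfork : ∀ v, ∃ i w, D.inn w = D.out v i) (m : ℕ) [NeZero m]
    (hm : D.degree = m) (ccw : Bool) :
    D.cls sk ∈ Submodule.span ℂ {(wheel m ccw).cls sk} := by
  classical
  choose ι c hιc using hfork
  have hcinj : Function.Injective c := fun v w h =>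
    (D.out_injective (((hιc v).symm.trans (congrArg D.inn h)).trans (hιc w))).1
  obtain ⟨c, rfl⟩ : ∃ σ : Equiv.Perm V, σ = c :=
    ⟨Equiv.ofBijective c hcinj.bijective_of_finite, rfl⟩
  -- the other outgoing arrow of each vertex is a leg
  have hleg : ∀ v w, D.inn w ≠ D.out v (1 - ι v) := by
    intro v w h
    obtain ⟨u, rfl⟩ := c.surjective w
    rw [hιc] at h
    obtain ⟨rfl, h⟩ := D.out_injective h
    revert h
    generalize ι u = i
    fin_cases i <;> simp
  have hcases : ∀ v i, D.out v i = D.inn (c v) ∨ D.out v i = D.out v (1 - ι v) := by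
    intro v i
    rw [hιc]
    generalize ι v = j
    fin_cases i <;> fin_cases j <;> simp
  have hedge : ∀ O : Set V, O.Nonempty → (∀ v, v ∈ O ↔ c v ∈ O) →
      ∀ e, ∃ v ∈ O, D.Incident v e := by
    rintro O ⟨v₀, hv₀⟩ hO e
    have hclosed : ∀ u v e, v ∈ O → D.Incident v e → D.Incident u e → u ∈ O := by
      rintro u v e hv (rfl | ⟨i, rfl⟩) (h | ⟨j, h⟩)
      · rwa [D.inn_injective h]
      · obtain ⟨w, rfl⟩ := c.surjective v
        rw [hιc] at h
        rwa [(D.out_injective h).1, hO]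
      · rcases hcases v i with h' | h'
        · rw [h'] at h
          rw [D.inn_injective h, ← hO]
          exact hv
        · exact absurd (h.trans h') (hleg v u)
      · rwa [(D.out_injective h).1]
    have hwalk : ∀ a b, D.edgeGraph.Walk a b → (∃ v ∈ O, D.Incident v a) →
        ∃ v ∈ O, D.Incident v b := by
      intro a b p
      induction p with
      | nil => exact id
      | cons hab _ ih =>
        rintro ⟨v, hv, hva⟩
        rw [edgeGraph, SimpleGraph.fromRel_adj] at hab
        rcases hab.2 with ⟨u, h1, h2⟩ | ⟨u, h2, h1⟩ <;>
          exact ih ⟨u, hclosed u v _ hv hva h1, h2⟩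
    obtain ⟨p⟩ := hD.preconnected (D.inn v₀) e
    exact hwalk _ _ p ⟨v₀, hv₀, Or.inl rfl⟩
  obtain ⟨n, hn, φ₀, hφ₀⟩ := exists_equiv_fin_of_transitive c (fun O hO hO' => by
    ext w
    simp only [Set.mem_univ, iff_true]
    obtain ⟨v, hv, h | ⟨i, h⟩⟩ := hedge O hO hO' (D.inn w)
    · rwa [← D.inn_injective h]
    · rcases hcases v i with h' | h'
      · rw [← D.inn_injective (h'.symm.trans h), ← hO']
        exact hv
      · exact absurd (h.symm.trans h') (hleg v w))
  set step : Fin n → Fin n := fun i => if ccw then i + 1 else i - 1 with hstep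
  -- the clockwise wheel is met when the cycle is numbered backwards
  obtain ⟨φ, hφ⟩ : ∃ φ : Fin n ≃ V, ∀ i, c (φ i) = φ (step i) := by
    cases ccw
    · refine ⟨(Equiv.neg (Fin n)).trans φ₀, fun i => ?_⟩
      simp only [hstep, Equiv.trans_apply, Equiv.neg_apply, hφ₀]
      congr 1
      simp
      abel
    · exact ⟨φ₀, fun i => by simp [hstep, hφ₀]⟩
  obtain ⟨ψ, hψl, hψr⟩ : ∃ ψ : Fin n ⊕ Fin n ≃ E, (∀ i, ψ (.inl i) = D.inn (φ i)) ∧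
      ∀ i, ψ (.inr i) = D.out (φ i) (1 - ι (φ i)) := by
    refine ⟨Equiv.ofBijective (Sum.elim (fun i => D.inn (φ i))
      fun i => D.out (φ i) (1 - ι (φ i))) ⟨?_, fun e => ?_⟩, fun _ => rfl, fun _ => rfl⟩
    · rintro (i | i) (j | j) h
      · exact congrArg _ (φ.injective (D.inn_injective h))
      · exact absurd h (hleg _ _)
      · exact absurd h.symm (hleg _ _)
      · exact congrArg _ (φ.injective (D.out_injective h).1)
    · obtain ⟨v, -, h⟩ := hedge Set.univ Set.univ_nonempty (by simp) e
      obtain ⟨i, rfl⟩ := φ.surjective v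
      rcases h with rfl | ⟨j, rfl⟩
      · exact ⟨.inl i, rfl⟩
      · rcases hcases (φ i) j with h | h
        · exact ⟨.inl (step i), by rw [h, hφ]; rfl⟩
        · exact ⟨.inr i, h.symm⟩
  obtain rfl : n = m := by
    have h1 := Fintype.card_congr φ
    have h2 := Fintype.card_congr ψ
    simp only [Fintype.card_sum, Fintype.card_fin] at h1 h2
    rw [degree] at hm
    omega
  set R := (wheel n ccw).relabel φ ψ with hR
  have hRinn : R.inn = D.inn := by
    funext v
    obtain ⟨i, rfl⟩ := φ.surjective v
    simp [hR, relabel, ofInjective, wheel, hψl]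
  have hheads : ∀ p ∈ D.base, p.2 = ArrowEnd.head := by
    rintro ⟨e, _ | _⟩ he
    · exfalso
      obtain ⟨i | i, rfl⟩ := ψ.surjective e
      · obtain ⟨w, hw⟩ := c.surjective (φ i)
        exact (D.tail_mem_base _).mp he w (ι w) (by rw [hψl, ← hw, hιc])
      · exact (D.tail_mem_base _).mp he _ _ (hψr i).symm
    · rfl
  have hRheads : ∀ p ∈ R.base, p.2 = ArrowEnd.head := by
    simp [hR, relabel, ofInjective, wheel]
  have hperm : D.base.Perm R.base := by
    rw [List.perm_ext_iff_of_nodup D.nodup_base R.nodup_base]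
    rintro ⟨e, _ | _⟩
    · exact ⟨fun h => by simpa using hheads _ h, fun h => by simpa using hRheads _ h⟩
    · rw [D.head_mem_base, R.head_mem_base, hRinn]
  rw [cls_eq_of_perm_heads sk hperm (D := D) (D' := D.withBase _ hperm) [] [] hheads rfl rfl
    (by simp) (by simp [withBase, ofInjective]), cls_eq_of_iso (iso_relabel sk _ φ ψ)]
  have hout : ∀ v, R.out v = D.out v ∨ R.out v = ![D.out v 1, D.out v 0] := by
    intro v
    obtain ⟨i, rfl⟩ := φ.surjective v
    have h1 : D.out (φ i) (ι (φ i)) = ψ (.inl (step i)) := by rw [hψl, ← hφ, hιc]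
    have h2 := (hψr i).symm
    have hRout : R.out (φ i) = if ccw then ![ψ (.inr i), ψ (.inl (step i))]
        else ![ψ (.inl (step i)), ψ (.inr i)] := by
      funext k
      cases ccw <;> fin_cases k <;> simp [hR, hstep, relabel, ofInjective, wheel]
    rw [hRout]
    revert h1 h2
    generalize ι (φ i) = j
    intro h1 h2
    obtain rfl | rfl : j = 0 ∨ j = 1 := by omega
    · rw [sub_zero] at h2
      cases ccw
      · exact Or.inl (by funext k; fin_cases k <;> simp [h1, h2])
      · exact Or.inr (by funext k; fin_cases k <;> simp [h1, h2])
    · rw [sub_self] at h2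
      cases ccw
      · exact Or.inr (by funext k; fin_cases k <;> simp [h1, h2])
      · exact Or.inl (by funext k; fin_cases k <;> simp [h1, h2])
  exact cls_mem_span_of_flips sk (Finset.univ.filter fun v => R.out v ≠ D.out v) hRinn rfl
    (fun v hv => by_contra fun h => hv (Finset.mem_filter.mpr ⟨Finset.mem_univ v, h⟩))
    (fun v hv => (hout v).resolve_left (Finset.mem_filter.mp hv).2)

/-! ### Classification of primitive diagrams -/

/-- In degree `m`, primitive diagrams with an internal vertex are multiples of the wheels. -/
theorem cls_mem_span_wheel (sk : Skeleton) (m : ℕ) [NeZero m] (ccw : Bool) (n : ℕ) :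
    ∀ (V E : Type) [Fintype V] [Fintype E] [Nonempty V] (D : LegalDiagram V E), D.IsPrimitive →
      D.degree = m → D.base.length = n →
      D.cls sk ∈ Submodule.span ℂ {(wheel m ccw).cls sk} := by
  induction n using Nat.strong_induction_on with
  | _ n ih =>
    intro V E _ _ _ D hD hm hn
    by_cases hfork : ∃ v, ∀ i w, D.inn w ≠ D.out v i
    · obtain ⟨v, hv⟩ := hfork
      exact cls_mem_of_fork sk _ D hD
        (fun U hU hdeg hlen => ih _ (hn ▸ hlen) _ _ U hU (hdeg.trans hm) rfl) v hv
    · push Not at hfork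
      exact cls_mem_span_wheel_of_no_fork sk D hD hfork m hm ccw

/-- Without internal vertices, different arrows are not joined. -/
theorem isTheta_of_isEmpty (sk : Skeleton) [IsEmpty V] (D : LegalDiagram V E)
    (hD : D.IsPrimitive) : D.IsTheta sk := by
  have hbot : D.edgeGraph = ⊥ := by
    ext a b
    simp [edgeGraph]
  have hsub : ∀ a b : E, a = b := by
    intro a b
    have h := hD.preconnected a b
    rwa [hbot, SimpleGraph.reachable_bot] at h
  classical
  obtain ⟨e⟩ := hD.nonempty
  have hperm : D.base.Perm [(e, .tail), (e, .head)] := by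
    rw [List.perm_ext_iff_of_nodup D.nodup_base (by simp)]
    rintro ⟨a, _ | _⟩
    · simp [D.tail_mem_base, hsub a e]
    · simp [D.head_mem_base, hsub a e]
  have hbase : D.base = [(e, .tail), (e, .head)] ∨ D.base = [(e, .head), (e, .tail)] := by
    rcases hb : D.base with _ | ⟨p, _ | ⟨q, _ | _⟩⟩ <;> rw [hb] at hperm
    · simpa using hperm.length_eq
    · simpa using hperm.length_eq
    · have hnd := hb ▸ D.nodup_base
      have h1 := (hperm.mem_iff (a := p)).mp (by simp)
      have h2 := (hperm.mem_iff (a := q)).mp (by simp)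
      simp only [List.mem_cons, List.not_mem_nil, or_false] at h1 h2
      rcases h1 with rfl | rfl <;> rcases h2 with rfl | rfl <;> simp at hnd ⊢
    · simpa using hperm.length_eq
  let ψ : E ≃ Unit := ⟨fun _ => (), fun _ => e, fun a => hsub e a, fun _ => rfl⟩
  refine ⟨decide (D.base = [(e, .tail), (e, .head)]), Equiv.equivOfIsEmpty V Empty, ψ,
    fun v => isEmptyElim v, fun v => isEmptyElim v, ?_⟩
  rcases hbase with h | h <;> simp [h, theta, SameLine.refl]

end Reduction

/-! ### Wheels -/

section Wheels

theorem degree_wheel (m : ℕ) [NeZero m] (ccw : Bool) : (wheel m ccw).degree = m := by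
  simp [degree]

theorem isPrimitive_wheel (m : ℕ) [NeZero m] (ccw : Bool) : (wheel m ccw).IsPrimitive := by
  have hrim : ∀ n : ℕ, (wheel m ccw).edgeGraph.Reachable (.inl 0) (.inl (Fin.ofNat m n)) := by
    intro n
    have hsucc : ∀ n, Fin.ofNat m (n + 1) = Fin.ofNat m n + 1 := fun n => by
      ext
      simp [Fin.val_add]
    induction n with
    | zero => exact SimpleGraph.Reachable.refl _
    | succ n ih =>
      refine ih.trans ?_
      cases ccw
      · exact (wheel m false).incident_reachable (v := Fin.ofNat m (n + 1))
          (Or.inr ⟨0, by rw [hsucc]; simp [wheel]⟩) (Or.inl rfl)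
      · exact (wheel m true).incident_reachable (v := Fin.ofNat m n) (Or.inl rfl)
          (Or.inr ⟨1, by rw [hsucc]; simp [wheel]⟩)
  have hrim' : ∀ i : Fin m, (wheel m ccw).edgeGraph.Reachable (.inl 0) (.inl i) := by
    intro i
    simpa using hrim i.val
  have key : ∀ e, (wheel m ccw).edgeGraph.Reachable (.inl 0) e := by
    rintro (i | i)
    · exact hrim' i
    · refine (hrim' i).trans ((wheel m ccw).incident_reachable (v := i) (Or.inl rfl) ?_)
      cases ccw
      · exact Or.inr ⟨1, by simp [wheel]⟩
      · exact Or.inr ⟨0, by simp [wheel]⟩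
  exact { preconnected := fun a b => (key a).symm.trans (key b), nonempty := ⟨.inl 0⟩ }

/-! ### Vanishing on the circle -/

/-- On the circle, a single leg pointing away from the line may be moved across its neighbours:
turning the line once around moves it across all other legs. -/
theorem cls_circle_eq_of_swap {V E : Type} [Fintype V] [Fintype E] {S T : LegalDiagram V E}
    {l : List (E × ArrowEnd)} {e f : E} (hl : ∀ p ∈ l, p.2 = ArrowEnd.head)
    (h : IsSwap S T l (e, .head) (f, .tail) []) : S.cls .circle = T.cls .circle := by
  obtain ⟨hi, ho, hS, hT⟩ := h
  have hS' : S.base.IsRotated ((f, .tail) :: (l ++ [(e, .head)])) := by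
    rw [hS, show l ++ [(e, ArrowEnd.head), (f, .tail)] = (l ++ [(e, .head)]) ++ [(f, .tail)] by simp]
    exact List.isRotated_append
  have hT' : T.base.IsRotated ((f, .tail) :: ((e, .head) :: l)) := by
    rw [hT]
    exact List.isRotated_append
  have h1 : S.cls .circle = (S.withBase _ hS'.perm).cls .circle :=
    cls_eq_of_iso ⟨Equiv.refl _, Equiv.refl _, fun _ => rfl, fun _ _ => rfl, by
      simpa [SameLine, withBase, ofInjective] using hS'⟩
  have h2 : T.cls .circle = (T.withBase _ hT'.perm).cls .circle :=
    cls_eq_of_iso ⟨Equiv.refl _, Equiv.refl _, fun _ => rfl, fun _ _ => rfl, by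
      simpa [SameLine, withBase, ofInjective] using hT'⟩
  rw [h1, h2]
  refine cls_eq_of_perm_heads .circle (A := l ++ [(e, .head)]) (A' := (e, .head) :: l)
    List.perm_append_comm [(f, .tail)] [] ?_ hi ho (by simp [withBase, ofInjective])
    (by simp [withBase, ofInjective])
  simpa [or_imp, forall_and] using hl

/-- A wheel with `k + 1` spokes cut open at its last vertex: the vertices `0, …, k - 1` lie on a path
of `k + 1` arrows, from the line back to the line, and each of them has a leg. -/
def cutWheel (k : ℕ) : LegalDiagram (Fin k) (Fin (k + 1) ⊕ Fin k) :=
  ofInjective (fun i => .inl i.castSucc) (fun i => ![.inr i, .inl i.succ])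
    ((List.finRange k).map (fun i => (.inr i, .head)) ++ [(.inl (Fin.last k), .head), (.inl 0, .tail)])
    (fun i j h => by simpa using h)
    (by
      intro i j a b h
      fin_cases a <;> fin_cases b <;> simp at h ⊢ <;> exact h)
    (by
      rw [List.nodup_append']
      refine ⟨(List.nodup_finRange k).map fun i j h => by simpa using h, by simp, ?_⟩
      simp [List.disjoint_left])
    (by
      rintro (i | i)
      · induction i using Fin.lastCases with
        | last => simp [Fin.castSucc_ne_last]
        | cast i => simp [Fin.castSucc_ne_last]
      · simp)
    (by
      rintro (i | i)
      · induction i using Fin.cases with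
        | zero => simp [Fin.forall_fin_two]
        | succ i => simp [Fin.forall_fin_two, Fin.succ_ne_zero]
      · simp [Fin.forall_fin_two])

/-- Closing the cut wheel by the relation STU exhibits a wheel as the difference of two diagrams that
agree on the circle. -/
theorem cls_circle_wheel_ccw (k : ℕ) : (wheel (k + 1) true).cls .circle = 0 := by
  set l : List ((Fin (k + 1) ⊕ Fin k) × ArrowEnd) :=
    (List.finRange k).map fun i => (.inr i, .head) with hl
  have hbase : (cutWheel k).base = l ++ (.inl (Fin.last k), .head) :: (.inl 0, .tail) :: [] := rfl
  have hp : (cutWheel k).base.Perm (l ++ (.inl 0, .tail) :: (.inl (Fin.last k), .head) :: []) := by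
    rw [hbase]
    exact (List.Perm.swap _ _ _).append_left l
  have hswap : IsSwap (cutWheel k) ((cutWheel k).withBase _ hp) l _ _ [] :=
    ⟨rfl, rfl, hbase, rfl⟩
  have hmerge := cls_sub_eq_merge .circle hswap
  rw [cls_circle_eq_of_swap (by simp [hl]) hswap, sub_self] at hmerge
  rw [hmerge]
  refine (cls_eq_of_iso ?_).symm
  let ψ : Option (Fin (k + 1) ⊕ Fin k) ≃ Fin (k + 1) ⊕ Fin (k + 1) :=
    { toFun := fun o => o.elim (.inr (Fin.last k)) (Sum.map id Fin.castSucc)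
      invFun := Sum.elim (fun i => some (.inl i)) (Fin.lastCases none fun i => some (.inr i))
      left_inv := by rintro (_ | i | i) <;> simp
      right_inv := by
        rintro (i | i)
        · simp
        · induction i using Fin.lastCases <;> simp }
  refine ⟨finSuccEquivLast.symm, ψ, ?_, ?_, ?_⟩
  · rintro (_ | i) <;> simp [merge, ofInjective, wheel, cutWheel, ψ]
  · rintro (_ | i) j <;> fin_cases j <;> simp [merge, ofInjective, wheel, cutWheel, ψ]
  · convert SameLine.refl _ _
    simp [merge, ofInjective, wheel, hl, ψ, List.finRange_succ_last, Function.comp_def]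

theorem cls_circle_eq_zero {V E : Type} [Fintype V] [Fintype E] [Nonempty V] (D : LegalDiagram V E)
    (hD : D.IsPrimitive) : D.cls .circle = 0 := by
  obtain ⟨k, hk⟩ := D.exists_degree_eq_succ
  simpa [cls_circle_wheel_ccw] using cls_mem_span_wheel .circle (k + 1) true _ V E D hD hk rfl

end Wheels

/-! ### A weight system on the interval -/

section WeightSystem

open Polynomial

/-- Structure constants of the nonabelian two-dimensional Lie algebra with basis `x = false` and
`y = true` and bracket `[x, y] = y`: the coefficient of the basis element `k` in `[a, b]`. -/
def structureConstant : Bool → Bool → Bool → ℂ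
  | true, false, true => 1
  | true, true, false => -1
  | _, _, _ => 0

theorem structureConstant_antisymm (k a b : Bool) :
    structureConstant k b a = -structureConstant k a b := by
  cases k <;> cases a <;> cases b <;> simp [structureConstant]

/-- The Jacobi identity `[[d, b], a] = [d, [b, a]] - [b, [d, a]]` in the form given by the IHX
relation: `n` is the label of the ingoing outer leg, and the inner arrow is summed over. -/
theorem structureConstant_jacobi (n a b d : Bool) :
    ∑ k, structureConstant n k a * structureConstant k d b =
      ∑ k, structureConstant n d k * structureConstant k b a -
        ∑ k, structureConstant n b k * structureConstant k d a := by
  cases n <;> cases a <;> cases b <;> cases d <;> simp [structureConstant]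

/-- A representation of the semidirect product of the Lie algebra with its dual, by elements of an
algebra: `op (a, .tail)` represents the basis element `a`, and `op (a, .head)` the element `a` of the
dual basis. -/
structure IsRepresentation {A : Type*} [Ring A] [Algebra ℂ A] (op : Bool × ArrowEnd → A) : Prop where
  tail_tail (a b : Bool) : op (a, .tail) * op (b, .tail) - op (b, .tail) * op (a, .tail) =
    ∑ k, structureConstant k a b • op (k, .tail)
  tail_head (a b : Bool) : op (a, .tail) * op (b, .head) - op (b, .head) * op (a, .tail) =
    ∑ k, structureConstant b k a • op (k, .head)
  head_head (a b : Bool) : op (a, .head) * op (b, .head) = op (b, .head) * op (a, .head)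

variable {V E : Type} [Fintype V] [Fintype E] {A : Type*} [Ring A] [Algebra ℂ A]
  (op : Bool × ArrowEnd → A)

/-- The product of the structure constants at the internal vertices, for a labelling of the arrows
by the basis. The outgoing arrows enter clockwise, which makes `stu_up_up` the commutator. -/
def vertexWeight (D : LegalDiagram V E) (lab : E → Bool) : ℂ :=
  ∏ v, structureConstant (lab (D.inn v)) (lab (D.out v 1)) (lab (D.out v 0))

/-- The product along the line of the operators at its external vertices. -/
def lineOperator (lab : E → Bool) (b : List (E × ArrowEnd)) : A :=
  (b.map fun p => op (lab p.1, p.2)).prod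

open Classical in
/-- The value of a diagram in the weight system: the sum over all labellings of its arrows. -/
noncomputable def weight (D : LegalDiagram V E) : A :=
  ∑ lab : E → Bool, D.vertexWeight lab • lineOperator op lab D.base

/-- The linear extension of `weight`. -/
noncomputable def weightMap : (AnyDiagram →₀ ℂ) →ₗ[ℂ] A :=
  Finsupp.linearCombination ℂ fun D => D.diagram.weight op

theorem weightMap_gen (D : LegalDiagram V E) : weightMap op D.gen = D.weight op := by
  simp [weightMap, gen]

omit [Fintype E] [Algebra ℂ A] in
theorem lineOperator_append (lab : E → Bool) (b b' : List (E × ArrowEnd)) :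
    lineOperator op lab (b ++ b') = lineOperator op lab b * lineOperator op lab b' := by
  simp [lineOperator]

omit [Fintype E] [Algebra ℂ A] in
theorem lineOperator_cons (lab : E → Bool) (p : E × ArrowEnd) (b : List (E × ArrowEnd)) :
    lineOperator op lab (p :: b) = op (lab p.1, p.2) * lineOperator op lab b := by
  simp [lineOperator]

theorem weight_eq_of_iso {V' E' : Type} [Fintype V'] [Fintype E'] (D : LegalDiagram V E)
    (D' : LegalDiagram V' E') (h : Iso .interval D D') : D.weight op = D'.weight op := by
  classical
  obtain ⟨φ, ψ, hinn, hout, hbase⟩ := h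
  unfold weight
  refine Fintype.sum_equiv (ψ.arrowCongr (Equiv.refl Bool)) _ _ fun lab => ?_
  congr 1
  · unfold vertexWeight
    refine Fintype.prod_equiv φ _ _ fun v => ?_
    simp [hinn, hout]
  · change D.base.map _ = D'.base at hbase
    rw [← hbase, lineOperator, lineOperator, List.map_map]
    congr 2
    ext p : 1
    simp

/-- A sum over labellings vanishes if the labels of one arrow already sum to zero. -/
theorem sum_labellings_eq_zero {M : Type*} [AddCommGroup M] [Module ℂ M] [DecidableEq E] (c : E)
    (F : (E → Bool) → M) (h : ∀ lab, ∑ b, F (Function.update lab c b) = 0) :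
    ∑ lab, F lab = 0 := by
  -- pair each labelling with the one that differs from it at `c` only
  have h1 : ∑ lab : E → Bool, F (Function.update lab c (!lab c)) = ∑ lab, F lab := by
    refine Finset.sum_nbij' (fun lab => Function.update lab c (!lab c))
      (fun lab => Function.update lab c (!lab c)) ?_ ?_ ?_ ?_ ?_ <;> simp
  have h2 : ∑ lab, F lab + ∑ lab, F lab = 0 := by
    nth_rewrite 2 [← h1]
    rw [← Finset.sum_add_distrib]
    refine Finset.sum_eq_zero fun lab _ => ?_
    rw [← h lab, Fintype.sum_bool]
    cases hl : lab c
    · rw [add_comm, ← hl, Function.update_eq_self]; simp [hl]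
    · rw [← hl, Function.update_eq_self]; simp [hl]
  rw [← two_smul ℂ] at h2
  exact (smul_eq_zero.mp h2).resolve_left two_ne_zero

theorem weight_flip (D D' : LegalDiagram V E) (v : V) (hinn : D'.inn = D.inn)
    (hbase : D'.base = D.base) (hv : D'.out v = ![D.out v 1, D.out v 0])
    (hout : ∀ u, u ≠ v → D'.out u = D.out u) : D.weight op + D'.weight op = 0 := by
  classical
  rw [weight, weight, ← Finset.sum_add_distrib]
  refine Finset.sum_eq_zero fun lab _ => ?_
  rw [hbase, ← add_smul]
  convert zero_smul ℂ _
  rw [vertexWeight, vertexWeight, ← Finset.mul_prod_erase _ _ (Finset.mem_univ v),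
    ← Finset.mul_prod_erase _ _ (Finset.mem_univ v), hinn, hv]
  rw [Finset.prod_congr rfl (g := fun u =>
    structureConstant (lab (D.inn u)) (lab (D.out u 1)) (lab (D.out u 0)))
    (s₁ := Finset.univ.erase v)
    (f := fun u => structureConstant (lab (D.inn u)) (lab (D'.out u 1)) (lab (D'.out u 0)))
    (fun u hu => by rw [hout u (Finset.ne_of_mem_erase hu)]), ← add_mul]
  simp [structureConstant_antisymm _ (lab (D.out v 0)) (lab (D.out v 1))]

theorem weight_ihx (I H X : LegalDiagram V E) (v w : V) (c x y z : E)
    (hvw : v ≠ w)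
    (hHi : H.inn = I.inn) (hXi : X.inn = I.inn)
    (hHb : H.base = I.base) (hXb : X.base = I.base)
    (hHo : ∀ u, u ≠ v → u ≠ w → H.out u = I.out u)
    (hXo : ∀ u, u ≠ v → u ≠ w → X.out u = I.out u)
    (hc : I.inn w = c)
    (hIv : I.out v = ![x, c]) (hIw : I.out w = ![y, z])
    (hHv : H.out v = ![c, z]) (hHw : H.out w = ![x, y])
    (hXv : X.out v = ![c, y]) (hXw : X.out w = ![x, z]) :
    I.weight op - (H.weight op - X.weight op) = 0 := by
  classical
  have hcv : I.out v 1 = c := by simp [hIv]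
  have hcx : x ≠ c := by
    rintro rfl
    simpa using (I.out_injective (v := v) (w := v) (i := 0) (j := 1) (by simp [hIv])).2
  have hcy : y ≠ c := by
    rintro rfl
    exact hvw (I.out_injective (v := v) (w := w) (i := 1) (j := 0) (by simp [hIv, hIw])).1
  have hcz : z ≠ c := by
    rintro rfl
    exact hvw (I.out_injective (v := v) (w := w) (i := 1) (j := 1) (by simp [hIv, hIw])).1
  have hci : ∀ u, u ≠ w → I.inn u ≠ c := fun u hu h => hu (I.inn_injective (h.trans hc.symm))
  have hco : ∀ u i, u ≠ v → I.out u i ≠ c :=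
    fun u i hu h => hu (I.out_injective (h.trans hcv.symm)).1
  have hcb : ∀ p ∈ I.base, p.1 ≠ c := by
    rintro ⟨e, _ | _⟩ hp rfl
    · exact (I.tail_mem_base _).mp hp v 1 hcv
    · exact (I.head_mem_base _).mp hp w hc
  -- the factors of the vertices other than `v` and `w` do not involve the label of `c`
  have hsplit : ∀ (D : LegalDiagram V E) (lab : E → Bool) (b : Bool), D.inn = I.inn →
      (∀ u, u ≠ v → u ≠ w → D.out u = I.out u) → D.vertexWeight (Function.update lab c b) =
        (∏ u ∈ (Finset.univ.erase v).erase w,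
          structureConstant (lab (I.inn u)) (lab (I.out u 1)) (lab (I.out u 0))) *
        (structureConstant (lab (I.inn v)) (if D.out v 1 = c then b else lab (D.out v 1))
            (if D.out v 0 = c then b else lab (D.out v 0)) *
          structureConstant b (if D.out w 1 = c then b else lab (D.out w 1))
            (if D.out w 0 = c then b else lab (D.out w 0))) := by
    intro D lab b hi ho
    rw [vertexWeight, ← Finset.mul_prod_erase _ _ (Finset.mem_univ v),
      ← Finset.mul_prod_erase _ _ (Finset.mem_erase.mpr ⟨hvw.symm, Finset.mem_univ w⟩), ← mul_assoc,
      mul_comm]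
    congr 1
    · refine Finset.prod_congr rfl fun u hu => ?_
      simp only [Finset.mem_erase] at hu
      rw [hi, ho u hu.2.1 hu.1, Function.update_of_ne (hci u hu.1),
        Function.update_of_ne (hco u 1 hu.2.1), Function.update_of_ne (hco u 0 hu.2.1)]
    · rw [hi, hc, Function.update_self, Function.update_of_ne (hci v hvw)]
      simp only [Function.update_apply]
  have hline : ∀ (lab : E → Bool) (b : Bool),
      lineOperator op (Function.update lab c b) I.base = lineOperator op lab I.base := by
    intro lab b
    unfold lineOperator
    congr 1
    exact List.map_congr_left fun p hp => by rw [Function.update_of_ne (hcb p hp)]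
  have hsum : I.weight op - (H.weight op - X.weight op) = ∑ lab : E → Bool,
      (I.vertexWeight lab - (H.vertexWeight lab - X.vertexWeight lab)) •
        lineOperator op lab I.base := by
    simp only [weight, hHb, hXb, sub_smul, Finset.sum_sub_distrib]
  rw [hsum]
  refine sum_labellings_eq_zero c _ fun lab => ?_
  simp only [hline, ← Finset.sum_smul]
  convert zero_smul ℂ _
  simp only [hsplit I lab _ rfl fun _ _ _ => rfl, hsplit H lab _ hHi hHo, hsplit X lab _ hXi hXo,
    hIv, hIw, hHv, hHw, hXv, hXw, Matrix.cons_val_zero, Matrix.cons_val_one, if_true, if_neg hcx,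
    if_neg hcy, if_neg hcz, ← mul_sub, ← Finset.mul_sum]
  rw [Finset.sum_sub_distrib, Finset.sum_sub_distrib, structureConstant_jacobi, sub_self, mul_zero]

/-- Reduction of the STU relations to an identity between the operators at two neighbouring external
vertices. -/
theorem weight_stu (S T : LegalDiagram V E) (U : LegalDiagram (Option V) (Option E))
    (l r : List (E × ArrowEnd)) (p q : E × ArrowEnd) (k : ArrowEnd) (hT : IsSwap S T l p q r)
    (hU : IsMerge S U l k r)
    (h : ∀ (lab : E → Bool), op (lab p.1, p.2) * op (lab q.1, q.2) -
        op (lab q.1, q.2) * op (lab p.1, p.2) =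
      ∑ b, structureConstant ((U.inn none).elim b lab) ((U.out none 1).elim b lab)
        ((U.out none 0).elim b lab) • op (b, k)) :
    S.weight op - T.weight op - U.weight op = 0 := by
  classical
  obtain ⟨hi, ho, hbS, hbT⟩ := hT
  obtain ⟨hUi, hUo, hUb⟩ := hU
  have hlist : ∀ (b : Bool) (lab : E → Bool) (s : List (E × ArrowEnd)),
      lineOperator op (fun o : Option E => o.elim b lab) (s.map fun p => (some p.1, p.2)) =
        lineOperator op lab s := by
    intro b lab s
    simp [lineOperator, Function.comp_def]
  have hUw : U.weight op = ∑ lab : E → Bool, ∑ b : Bool,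
      U.vertexWeight (fun o => o.elim b lab) •
        lineOperator op (fun o : Option E => o.elim b lab) U.base := by
    let F : (E → Bool) → Bool → A := fun lab b =>
      U.vertexWeight (fun o => o.elim b lab) •
        lineOperator op (fun o : Option E => o.elim b lab) U.base
    let split : (Option E → Bool) ≃ (E → Bool) × Bool :=
      { toFun := fun g => (fun e => g (some e), g none)
        invFun := fun x o => o.elim x.2 x.1
        left_inv := fun g => by funext o; cases o <;> rfl
        right_inv := fun x => rfl }
    change _ = ∑ lab, ∑ b, F lab b
    rw [weight, ← Fintype.sum_prod_type' F]
    refine Finset.sum_equiv split (by simp) fun g _ => ?_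
    simp only [F]
    have : (fun o : Option E => o.elim (split g).2 (split g).1) = g := split.symm_apply_apply g
    rw [this]
  rw [hUw, weight, weight, ← Finset.sum_sub_distrib, ← Finset.sum_sub_distrib]
  refine Finset.sum_eq_zero fun lab _ => ?_
  have hvT : T.vertexWeight lab = S.vertexWeight lab := by simp [vertexWeight, hi, ho]
  have hvU : ∀ b, U.vertexWeight (fun o => o.elim b lab) =
      S.vertexWeight lab * structureConstant ((U.inn none).elim b lab)
        ((U.out none 1).elim b lab) ((U.out none 0).elim b lab) := by
    intro b
    simp [vertexWeight, Fintype.prod_option, hUi, hUo, mul_comm]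
  simp only [hvT, hvU, hbS, hbT, hUb, lineOperator_append, lineOperator_cons, hlist, mul_smul,
    ← Finset.smul_sum, ← smul_sub]
  have h' := congrArg (fun f => lineOperator op lab l * f * lineOperator op lab r) (h lab)
  simp only [mul_sub, sub_mul, Finset.mul_sum, Finset.sum_mul, mul_smul_comm, smul_mul_assoc] at h'
  simp only [mul_assoc] at h' ⊢
  simp only [Option.elim_none]
  rw [h', sub_self, smul_zero]

theorem weightMap_relator (hop : IsRepresentation op) {x : AnyDiagram →₀ ℂ} (hx : IsRelator .interval x) :
    weightMap op x = 0 := by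
  induction hx with
  | iso D D' h => rw [map_sub, weightMap_gen, weightMap_gen, weight_eq_of_iso op D D' h, sub_self]
  | antisymm D D' v hinn hbase hv hout =>
    rw [map_add, weightMap_gen, weightMap_gen, weight_flip op D D' v hinn hbase hv hout]
  | ihx I H X v w c x y z hvw hHi hXi hHb hXb hHo hXo hc hIv hIw hHv hHw hXv hXw =>
    rw [map_sub, map_sub, weightMap_gen, weightMap_gen, weightMap_gen]
    exact weight_ihx op I H X v w c x y z hvw hHi hXi hHb hXb hHo hXo hc hIv hIw hHv hHw hXv hXw
  | stu_up_up S T U l r e f hT hU hinn hout =>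
    rw [map_sub, map_sub, weightMap_gen, weightMap_gen, weightMap_gen]
    refine weight_stu op S T U l r _ _ _ hT hU fun lab => ?_
    rw [hinn, hout, hop.tail_tail]
    rfl
  | stu_up_down S T U l r e f hT hU hinn hout =>
    rw [map_sub, map_sub, weightMap_gen, weightMap_gen, weightMap_gen]
    refine weight_stu op S T U l r _ _ _ hT hU fun lab => ?_
    rw [hinn, hout, hop.tail_head]
    rfl
  | stu_down_up S T U l r e f hT hU hinn hout =>
    rw [map_sub, map_sub, weightMap_gen, weightMap_gen, weightMap_gen]
    refine weight_stu op S T U l r _ _ _ hT hU fun lab => ?_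
    rw [hinn, hout, ← neg_sub, hop.tail_head, ← Finset.sum_neg_distrib]
    refine Finset.sum_congr rfl fun b _ => ?_
    rw [← neg_smul, ← structureConstant_antisymm]
    rfl
  | stu_down_down S T l r e f hT =>
    obtain ⟨hi, ho, hS, hT⟩ := hT
    rw [map_sub, weightMap_gen, weightMap_gen, sub_eq_zero]
    unfold weight
    refine Finset.sum_congr rfl fun lab _ => ?_
    have hv : T.vertexWeight lab = S.vertexWeight lab := by simp [vertexWeight, hi, ho]
    rw [hv, hS, hT]
    simp only [lineOperator_append, lineOperator_cons]
    rw [← mul_assoc (op _), hop.head_head, mul_assoc]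

/-- A diagram of nonzero weight has a nonzero class. -/
theorem cls_ne_zero_of_weight_ne_zero (hop : IsRepresentation op) (D : LegalDiagram V E)
    (h : D.weight op ≠ 0) :
    D.cls .interval ≠ 0 := by
  intro h0
  have h1 := (Submodule.Quotient.mk_eq_zero _).mp h0
  have h2 : Submodule.span ℂ {x | IsRelator .interval x} ≤ LinearMap.ker (weightMap op) :=
    Submodule.span_le.mpr fun x hx => weightMap_relator op hop hx
  exact h ((weightMap_gen op D).symm.trans (h2 h1))

/-- A representation on `ℂ[X]`: the basis acts by `x ↦ -X d/dX` and `y ↦ d/dX`, the dual basis by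
`x* ↦ 1` and `y* ↦ X`. -/
noncomputable def endOperator : Bool × ArrowEnd → Module.End ℂ ℂ[X]
  | (false, .tail) => -(LinearMap.mulLeft ℂ X * derivative)
  | (true, .tail) => derivative
  | (false, .head) => 1
  | (true, .head) => LinearMap.mulLeft ℂ X

theorem endOperator_tail_tail (a b : Bool) :
    endOperator (a, .tail) * endOperator (b, .tail) - endOperator (b, .tail) * endOperator (a, .tail)
      = ∑ k, structureConstant k a b • endOperator (k, .tail) := by
  cases a <;> cases b <;> ext1 n <;> ext1 <;> simp [structureConstant, endOperator]

theorem endOperator_tail_head (a b : Bool) :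
    endOperator (a, .tail) * endOperator (b, .head) - endOperator (b, .head) * endOperator (a, .tail)
      = ∑ k, structureConstant b k a • endOperator (k, .head) := by
  cases a <;> cases b <;> refine LinearMap.ext fun p => ?_ <;>
    simp [structureConstant, endOperator]
  ring

theorem endOperator_head_head (a b : Bool) :
    endOperator (a, .head) * endOperator (b, .head) =
      endOperator (b, .head) * endOperator (a, .head) := by
  cases a <;> cases b <;> simp [endOperator]

theorem isRepresentation_endOperator : IsRepresentation endOperator :=
  ⟨endOperator_tail_tail, endOperator_tail_head, endOperator_head_head⟩

/-- Only the labelling with `y` on the rim and `x` on the legs contributes to the weight of a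
wheel. -/
theorem weight_wheel (m : ℕ) [NeZero m] (ccw : Bool) :
    (wheel m ccw).weight endOperator = (if ccw then (-1 : ℂ) ^ m else 1) • 1 := by
  classical
  rw [weight, Finset.sum_eq_single (Sum.elim (fun _ => true) fun _ => false)]
  · congr 1
    · cases ccw <;> simp [vertexWeight, wheel, structureConstant]
    · simp [lineOperator, wheel, endOperator, Function.comp_def]
  · intro lab _ hlab
    convert zero_smul ℂ _
    by_contra hne
    have hv := fun v => Finset.prod_ne_zero_iff.mp hne v (Finset.mem_univ v)
    have hy : ∀ i, lab (.inl i) = true := by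
      intro i
      have h := hv i
      cases hi : lab (.inl i)
      · simp [wheel, hi, structureConstant] at h
      · rfl
    apply hlab
    funext e
    rcases e with i | i
    · exact hy i
    · have h := hv i
      cases hi : lab (.inr i)
      · rfl
      · cases ccw <;> simp [wheel, hi, hy, structureConstant] at h
  · simp

theorem cls_wheel_ne_zero (m : ℕ) [NeZero m] (ccw : Bool) :
    (wheel m ccw).cls .interval ≠ 0 := by
  refine cls_ne_zero_of_weight_ne_zero endOperator isRepresentation_endOperator _ ?_
  rw [weight_wheel]
  refine smul_ne_zero ?_ one_ne_zero
  cases ccw <;> simp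

end WeightSystem

end LegalDiagram

theorem mainTheorem6 :
    -- on the interval, every directed wheel is a primitive diagram and is nonzero
    (∀ (m : ℕ) [NeZero m] (ccw : Bool),
      (LegalDiagram.wheel m ccw).IsPrimitive ∧
      (LegalDiagram.wheel m ccw).degree = m ∧
      (LegalDiagram.wheel m ccw).cls Skeleton.interval ≠ 0) ∧
    -- on the interval, wheels (and possibly directed thetas) are the only nonzero primitives
    (∀ (V E : Type) [Fintype V] [Fintype E] (D : LegalDiagram V E), D.IsPrimitive →
      D.IsTheta Skeleton.interval ∨
      ∃ (m : ℕ) (_ : NeZero m), D.degree = m ∧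
        ∀ ccw : Bool, ∃ a : ℂ,
          D.cls Skeleton.interval = a • (LegalDiagram.wheel m ccw).cls Skeleton.interval) ∧
    -- on the circle, wheels and all other primitives except possibly theta vanish
    (∀ (m : ℕ) [NeZero m] (ccw : Bool),
      (LegalDiagram.wheel m ccw).cls Skeleton.circle = 0) ∧
    (∀ (V E : Type) [Fintype V] [Fintype E] (D : LegalDiagram V E), D.IsPrimitive →
      D.IsTheta Skeleton.circle ∨ D.cls Skeleton.circle = 0) := by
  refine ⟨fun m _ ccw => ⟨LegalDiagram.isPrimitive_wheel m ccw, LegalDiagram.degree_wheel m ccw,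
    LegalDiagram.cls_wheel_ne_zero m ccw⟩, fun V E _ _ D hD => ?_,
    fun m _ ccw => LegalDiagram.cls_circle_eq_zero _ (LegalDiagram.isPrimitive_wheel m ccw),
    fun V E _ _ D hD => ?_⟩
  · rcases isEmpty_or_nonempty V with _ | _
    · exact Or.inl (LegalDiagram.isTheta_of_isEmpty _ D hD)
    · obtain ⟨k, hk⟩ := D.exists_degree_eq_succ
      refine Or.inr ⟨k + 1, inferInstance, hk, fun ccw => ?_⟩
      obtain ⟨a, ha⟩ := Submodule.mem_span_singleton.mp
        (LegalDiagram.cls_mem_span_wheel .interval (k + 1) ccw _ V E D hD hk rfl)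
      exact ⟨a, ha.symm⟩
  · rcases isEmpty_or_nonempty V with _ | _
    · exact Or.inl (LegalDiagram.isTheta_of_isEmpty _ D hD)
    · exact Or.inr (LegalDiagram.cls_circle_eq_zero D hD)
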